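/- Let $V$ be a real-valued Radon measure on $\mathbb R^3$ (a signed measure of locally bounded variation; a locally integrable function $V$ is identified with $V(x)\,dx$), with total variation $|V|$, in the Kato class $\mathcal K$, meaning that $$\|V\|_{\mathcal K} := \sup_{y\in\mathbb R^3}\int_{\mathbb R^3}\frac{d|V|(x)}{|x-y|}<\infty .$$ Let $\mathcal K_0$ be the closure in $\mathcal K$ of the real-valued test functions $C_c^\infty(\mathbb R^3)$. Let $$S(t)(x,y)=\chi_{t\ge 0}\,\frac{1}{4\pi t}\,V(x)\,\delta_t(|x-y|),$$ that is, for each $y$, $S(\cdot)(\cdot,y)$ is the signed measure $\chi_{t\ge0}\frac{1}{4\pi t}\,V(dx)\,\delta_{|x-y|}(dt)$ on $\mathbb R^3_x\times\mathbb R_t$. For kernels of this type, given for each $y$ by a signed measure in $(x,\rho)$, let $$\|K\|_{L^\infty_y\mathcal M_xL^1_\rho}=\sup_{y\in\mathbb R^3}\ \bigl(\text{total variation of } K(\cdot)(\cdot,y) \text{ on } \mathbb R^3_x\times\mathbb R_\rho\bigr),$$ and let $S^2$ be the repeated convolution $S^2(t)(x,y)=\int_{\mathbb R}\int_{\mathbb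 R^3}S(t-s)(x,z)\,S(s)(z,y)\,dz\,ds$ (understood in the sense of measures). 1. If $V$ has the distal Kato property $$\lim_{R\to\infty}\ \sup_{y\in\mathbb R^3}\int_{|x-y|>R}\frac{d|V|(x)}{|x-y|}=0,$$ then $S$ decays at infinity: $$\lim_{R\to\infty}\|\chi_{\rho\ge R}S(\rho)\|_{L^\infty_y\mathcal M_xL^1_\rho}=0.$$ 2. If $V\in\mathcal K_0$, then $S^2$ is continuous under translation: $$\lim_{\epsilon\to0}\|S^2(\rho+\epsilon)-S^2(\rho)\|_{L^\infty_y\mathcal M_xL^1_\rho}=0.$$ -/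

import Mathlib

open MeasureTheory ProbabilityTheory Filter Topology
open scoped ENNReal

namespace KatoWiener

/-- Three-dimensional Euclidean space. -/
abbrev E3 : Type := EuclideanSpace ℝ (Fin 3)

/-! ### Total variation of a difference of two positive measures -/

/-- The total variation measure `|μ - ν|`, as the sum of the positive part `(μ - ν)₊`
(the least positive measure `τ` with `μ ≤ τ + ν`, Mathlib's `μ - ν`) and the negative part
`(ν - μ)₊`. -/
noncomputable def absDiff {X : Type*} [MeasurableSpace X] (μ ν : Measure X) : Measure X :=
  (μ - ν) + (ν - μ)

/-! ### Potentials and the Kato class -/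

/-- A real-valued (signed) Radon measure `V` on `ℝ³`, that is, a real measure of locally bounded
variation, possibly with `V₊(ℝ³) = V₋(ℝ³) = ∞`, given by its Jordan decomposition `V = V₊ - V₋`.
A locally integrable function `V` is the case `V₊ = max(V, 0) dx`, `V₋ = max(-V, 0) dx`. -/
structure SignedRadon where
  pos : Measure E3
  neg : Measure E3
  pos_finite : IsFiniteMeasureOnCompacts pos
  neg_finite : IsFiniteMeasureOnCompacts neg
  mutuallySingular : pos ⟂ₘ neg

attribute [instance] SignedRadon.pos_finite SignedRadon.neg_finite

namespace SignedRadon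

/-- The total variation measure `|V|`. -/
noncomputable def variation (V : SignedRadon) : Measure E3 := V.pos + V.neg

/-- The total variation measure `|V - φ dx|`. -/
noncomputable def variationSub (V : SignedRadon) (φ : E3 → ℝ) : Measure E3 :=
  absDiff (V.pos + volume.withDensity fun x => ENNReal.ofReal (-φ x))
    (V.neg + volume.withDensity fun x => ENNReal.ofReal (φ x))

end SignedRadon

/-- `sup_y ∫ dμ(x) / |x - y|` for a positive measure `μ`; with `μ = |V|` this is the Kato norm
of `V`. The integrand is `∞` at `x = y`. -/
noncomputable def katoNorm (μ : Measure E3) : ℝ≥0∞ :=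
  ⨆ y : E3, ∫⁻ x, ‖x - y‖ₑ⁻¹ ∂μ

namespace SignedRadon

/-- `V` belongs to the Kato class `𝒦`. -/
def IsKato (V : SignedRadon) : Prop := katoNorm V.variation < ⊤

/-- The distal Kato property. -/
def IsDistal (V : SignedRadon) : Prop :=
  Tendsto (fun R : ℝ => ⨆ y : E3, ∫⁻ x in {x | R < ‖x - y‖}, ‖x - y‖ₑ⁻¹ ∂V.variation)
    atTop (𝓝 0)

/-- `V` belongs to `𝒦₀`, the closure in `𝒦` of the real-valued test functions. -/
def IsKatoZero (V : SignedRadon) : Prop :=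
  V.IsKato ∧ ∀ ε : ℝ≥0∞, 0 < ε → ∃ φ : E3 → ℝ, ContDiff ℝ (⊤ : ℕ∞) φ ∧ HasCompactSupport φ ∧
    katoNorm (V.variationSub φ) < ε

end SignedRadon

/-! ### Time-dependent kernels -/

/-- A time-dependent operator kernel `K(t)(x, y)` on `ℝ³`, viewed for each `y` as a signed
measure in `(x, t)` that depends measurably on `y`. It is represented as a difference
`K = K.pos - K.neg` of positive kernels, which need not be its Jordan decomposition. -/
structure TimeKernel where
  pos : Kernel E3 (E3 × ℝ)
  neg : Kernel E3 (E3 × ℝ)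
  pos_sFinite : IsSFiniteKernel pos
  neg_sFinite : IsSFiniteKernel neg

attribute [instance] TimeKernel.pos_sFinite TimeKernel.neg_sFinite

namespace TimeKernel

/-- The norm of `L^∞_y ℳ_x L¹_ρ`: the supremum over `y` of the total variation, in `(x, ρ)`, of
`K(ρ)(x, y)`. -/
noncomputable def norm (K : TimeKernel) : ℝ≥0∞ :=
  ⨆ y : E3, absDiff (K.pos y) (K.neg y) Set.univ

/-- The difference `K - L`. -/
noncomputable def sub (K L : TimeKernel) : TimeKernel where
  pos := K.pos + L.neg
  neg := K.neg + L.pos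
  pos_sFinite := inferInstance
  neg_sFinite := inferInstance

/-- The truncation `χ_{ρ ≥ R} K(ρ)`. -/
noncomputable def truncGE (R : ℝ) (K : TimeKernel) : TimeKernel where
  pos := K.pos.restrict (measurableSet_le measurable_const measurable_snd :
    MeasurableSet {p : E3 × ℝ | R ≤ p.2})
  neg := K.neg.restrict (measurableSet_le measurable_const measurable_snd :
    MeasurableSet {p : E3 × ℝ | R ≤ p.2})
  pos_sFinite := inferInstance
  neg_sFinite := inferInstance

/-- The translate `ρ ↦ K(ρ + ε)`: a point mass of `K` at time `t` is moved to time `t - ε`. -/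
noncomputable def translate (ε : ℝ) (K : TimeKernel) : TimeKernel where
  pos := K.pos.map fun p => (p.1, p.2 - ε)
  neg := K.neg.map fun p => (p.1, p.2 - ε)
  pos_sFinite := inferInstance
  neg_sFinite := inferInstance

/-- Composition in space and convolution in time of positive kernels,
`(κ * η)(t)(x, y) = ∫ ∫ κ(t - s)(x, z) η(s)(z, y) dz ds`: for fixed `y`, the image of
`η(ds)(dz, y) κ(dr)(dx, z)` under `(z, s, x, r) ↦ (x, s + r)`. -/
noncomputable def convPos (κ η : Kernel E3 (E3 × ℝ)) : Kernel E3 (E3 × ℝ) :=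
  (η ⊗ₖ (κ.comap (fun q : E3 × (E3 × ℝ) => q.2.1)
    (measurable_fst.comp measurable_snd))).map fun w => (w.2.1, w.1.2 + w.2.2)

instance (κ η : Kernel E3 (E3 × ℝ)) : IsSFiniteKernel (convPos κ η) := by
  unfold convPos; infer_instance

/-- The convolution product `K * L`, extended bilinearly from positive kernels. -/
noncomputable def conv (K L : TimeKernel) : TimeKernel where
  pos := convPos K.pos L.pos + convPos K.neg L.neg
  neg := convPos K.pos L.neg + convPos K.neg L.pos
  pos_sFinite := inferInstance
  neg_sFinite := inferInstance

end TimeKernel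

/-! ### The kernel `S` -/

/-- The function `χ_{t ≥ 0} / (4 π t)`. Its value at `t = 0` is irrelevant below: a measure of
finite Kato norm has no atoms, so for such `V` the kernel `S` has no mass at `t = 0`. -/
noncomputable def waveWeight (t : ℝ) : ℝ≥0∞ :=
  ENNReal.ofReal (if 0 ≤ t then 1 / (4 * Real.pi * t) else 0)

/-- For a positive measure `μ`, the kernel `χ_{t ≥ 0} (4 π t)⁻¹ μ(dx) δ_{|x-y|}(dt)`. -/
noncomputable def waveKernel (μ : Measure E3) [SFinite μ] : Kernel E3 (E3 × ℝ) :=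
  (Kernel.const E3 μ ⊗ₖ Kernel.deterministic (fun q : E3 × E3 => ‖q.2 - q.1‖)
    (by fun_prop)).withDensity fun _ p => waveWeight p.2

instance (μ : Measure E3) [SFinite μ] : IsSFiniteKernel (waveKernel μ) :=
  Kernel.IsSFiniteKernel.withDensity _ fun _ _ => ENNReal.ofReal_ne_top

/-- The kernel `S(t)(x, y) = χ_{t ≥ 0} (4 π t)⁻¹ V(x) δ_t(|x - y|)`. -/
noncomputable def S (V : SignedRadon) : TimeKernel where
  pos := waveKernel V.pos
  neg := waveKernel V.neg
  pos_sFinite := inferInstance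
  neg_sFinite := inferInstance

end KatoWiener

/-! Decay is direct: the mass of `S` at times `ρ ≥ R` is at most the integral of `1 / |x - y|`
against `|V|` over `|x - y| ≥ R`, which the distal property controls.

For continuity, composition of wave kernels is bilinear and bounded by the product of Kato norms
(`waveConv_le`), so `V` may be replaced by a test function `φ` close to it in Kato norm
(`waveConv_square_near`). For densities and a pole `y`, recentring at `y` presents the composition
as the image of a weighted measure on pairs `(x, z)` under `(x, z) ↦ (x, |z| + |x - z|)`. The image
is absolutely continuous (`pairMeasure_absolutelyContinuous`), so its time translates converge in
`L¹`. The square is essential here: `S` itself lives on the null cone `ρ = |x - y|`. Uniformity in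
`y` follows from compactness for bounded `y`, the recentred measure being continuous in `y` in total
variation, and from smallness of the composition for distant `y`.

Signed objects are pairs of positive measures, and each estimate is a setwise inequality without
subtraction, `μ A ≤ ν A + e`; a Hahn decomposition converts these into total variation bounds. -/

namespace KatoWiener

/-! ### Total variation from setwise inequalities -/

section Measure

variable {X : Type*} [MeasurableSpace X]

/-- On the Hahn set where `μ ≤ ν` the truncated difference vanishes; on its complement it is a true
difference, so `h` on that one set suffices. -/
theorem sub_apply_univ_le {μ ν : Measure X} [IsFiniteMeasure μ] [IsFiniteMeasure ν] {e : ℝ≥0∞}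
    (h : ∀ A, MeasurableSet A → μ A ≤ ν A + e) : (μ - ν) Set.univ ≤ e := by
  obtain ⟨s, hs⟩ := exists_isHahnDecomposition μ ν
  have hm := hs.measurableSet
  rw [← measure_add_measure_compl hm,
    Measure.sub_apply_eq_zero_of_restrict_le_restrict hs.le_on hm, zero_add,
    ← Measure.restrict_apply_self,
    Measure.restrict_sub_eq_restrict_sub_restrict hm.compl,
    Measure.sub_apply hm.compl hs.ge_on_compl, Measure.restrict_apply_self,
    Measure.restrict_apply_self, tsub_le_iff_left]
  exact h _ hm.compl

theorem absDiff_univ_le {μ ν : Measure X} [IsFiniteMeasure μ] [IsFiniteMeasure ν] {e : ℝ≥0∞}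
    (h : ∀ A, MeasurableSet A → μ A ≤ ν A + e) (h' : ∀ A, MeasurableSet A → ν A ≤ μ A + e) :
    absDiff μ ν Set.univ ≤ e + e :=
  add_le_add (sub_apply_univ_le h) (sub_apply_univ_le h')

theorem absDiff_le_add (μ ν : Measure X) : absDiff μ ν ≤ μ + ν :=
  add_le_add Measure.sub_le Measure.sub_le

end Measure

/-- Neither measure need be finite: the finite case is applied on closed balls, which then exhaust
the space. -/
theorem le_sub_add (μ ν : Measure E3) [IsFiniteMeasureOnCompacts μ]
    [IsFiniteMeasureOnCompacts ν] : μ ≤ (μ - ν) + ν := by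
  refine Measure.le_iff.2 fun A hA => ?_
  have key : ∀ n : ℕ, μ (A ∩ Metric.closedBall 0 n) ≤ ((μ - ν) + ν) A := fun n => by
    have hB : MeasurableSet (Metric.closedBall (0 : E3) n) := Metric.isClosed_closedBall.measurableSet
    have hc := isCompact_closedBall (0 : E3) n
    have : IsFiniteMeasure (μ.restrict (Metric.closedBall 0 n)) :=
      isFiniteMeasure_restrict.2 hc.measure_lt_top.ne
    have : IsFiniteMeasure (ν.restrict (Metric.closedBall 0 n)) :=
      isFiniteMeasure_restrict.2 hc.measure_lt_top.ne
    have h := (Measure.sub_le_iff_le_add (μ := μ.restrict (Metric.closedBall 0 n))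
      (ν := ν.restrict (Metric.closedBall 0 n))).1 le_rfl
    rw [← Measure.restrict_sub_eq_restrict_sub_restrict hB, ← Measure.restrict_add] at h
    have h2 := h A
    rw [Measure.restrict_apply hA, Measure.restrict_apply hA] at h2
    exact h2.trans (measure_mono Set.inter_subset_left)
  have hU : A = ⋃ n : ℕ, A ∩ Metric.closedBall (0 : E3) n := by
    rw [← Set.inter_iUnion, Metric.iUnion_closedBall_nat, Set.inter_univ]
  have hmono : Monotone fun n : ℕ => A ∩ Metric.closedBall (0 : E3) n := fun m n h =>
    Set.inter_subset_inter_right _ (Metric.closedBall_subset_closedBall (by exact_mod_cast h))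
  conv_lhs => rw [hU]
  rw [hmono.measure_iUnion]
  exact iSup_le key

/-! ### Translation in time -/

/-- The translation in time by `-ε`. -/
def timeShift (ε : ℝ) (p : E3 × ℝ) : E3 × ℝ := (p.1, p.2 - ε)

theorem measurable_timeShift (ε : ℝ) : Measurable (timeShift ε) := by
  unfold timeShift; fun_prop

theorem timeShift_neg_preimage (ε : ℝ) (A : Set (E3 × ℝ)) :
    timeShift (-ε) ⁻¹' (timeShift ε ⁻¹' A) = A := by
  ext p; simp [timeShift]

theorem timeShift_eq_add (ε : ℝ) : timeShift ε = fun p => p + ((0 : E3), -ε) := by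
  funext p; ext <;> simp [timeShift, sub_eq_add_neg]

instance : (volume : Measure (E3 × ℝ)).IsAddRightInvariant :=
  inferInstanceAs ((volume : Measure E3).prod (volume : Measure ℝ)).IsAddRightInvariant

theorem measurePreserving_timeShift (ε : ℝ) : MeasurePreserving (timeShift ε) := by
  rw [timeShift_eq_add]; exact measurePreserving_add_right volume _

/-- Translation in time is continuous in `L¹`. -/
theorem tendsto_lintegral_timeShift_sub {f : E3 × ℝ → ℝ} (hf : Integrable f) :
    Tendsto (fun ε : ℝ => ∫⁻ p, ‖f (timeShift ε p) - f p‖ₑ) (𝓝 0) (𝓝 0) := by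
  have : Fact ((1 : ℝ≥0∞) ≤ 1) := ⟨le_rfl⟩
  let F : Lp ℝ 1 (volume : Measure (E3 × ℝ)) := hf.toL1 f
  let g : ℝ → C(E3 × ℝ, E3 × ℝ) := fun ε => ⟨timeShift ε, by unfold timeShift; fun_prop⟩
  have hg : Continuous g := by
    apply ContinuousMap.continuous_of_continuous_uncurry
    simp only [Function.uncurry_def, g, ContinuousMap.coe_mk, timeShift]
    fun_prop
  -- Composition of an `L¹` function with a continuous family of measure-preserving maps is
  -- continuous in the parameter.
  have hc : Continuous fun ε => Lp.compMeasurePreserving (g ε) (measurePreserving_timeShift ε) F :=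
    continuous_const.compMeasurePreservingLp hg (fun ε => measurePreserving_timeShift ε) (by simp)
  have h0 : Lp.compMeasurePreserving (g 0) (measurePreserving_timeShift 0) F = F := by
    have : timeShift 0 = id := by funext p; simp [timeShift]
    apply Lp.ext
    refine (Lp.coeFn_compMeasurePreserving F _).trans ?_
    simp [g, this]
  have h1 := hc.tendsto 0
  rw [h0, tendsto_iff_edist_tendsto_0] at h1
  refine h1.congr fun ε => ?_
  rw [Lp.edist_def, eLpNorm_one_eq_lintegral_enorm]
  refine lintegral_congr_ae ?_
  have e1 := Lp.coeFn_compMeasurePreserving F (measurePreserving_timeShift ε)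
  have e2 : F =ᵐ[volume] f := hf.coeFn_toL1
  have e3 := (measurePreserving_timeShift ε).quasiMeasurePreserving.ae_eq_comp e2
  filter_upwards [e1, e2, e3] with p q1 q2 q3
  simp only [Pi.sub_apply]
  have q1' : (Lp.compMeasurePreserving (g ε) (measurePreserving_timeShift ε) F) p = f (timeShift ε p) :=
    q1.trans q3
  rw [q1', q2]

/-- Translation in time is continuous in total variation at an absolutely continuous measure. -/
theorem eventually_timeShift_le {P : Measure (E3 × ℝ)} [IsFiniteMeasure P] (hP : P ≪ volume)
    {δ : ℝ≥0∞} (hδ : 0 < δ) :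
    ∀ᶠ ε : ℝ in 𝓝 0, ∀ A, MeasurableSet A → P (timeShift ε ⁻¹' A) ≤ P A + δ := by
  have hi : Integrable (fun p => (P.rnDeriv volume p).toReal) := Measure.integrable_toReal_rnDeriv
  have hm := Measure.measurable_rnDeriv P volume
  have ht := tendsto_lintegral_timeShift_sub hi
  -- The change of variables in `e1` evaluates the density at the shift by `-ε`.
  have hneg : Tendsto (fun ε : ℝ => -ε) (𝓝 0) (𝓝 0) := by
    simpa using (continuous_neg (G := ℝ)).tendsto 0
  filter_upwards [(ht.comp hneg).eventually (gt_mem_nhds hδ)] with ε hε A hA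
  have hA' := measurable_timeShift ε hA
  have := Measure.haveLebesgueDecomposition_of_sigmaFinite P (volume : Measure (E3 × ℝ))
  have hPA : ∀ B, P B = ∫⁻ p in B, P.rnDeriv volume p := fun B => by
    rw [Measure.setLIntegral_rnDeriv hP]
  have hfin := Measure.rnDeriv_lt_top P (volume : Measure (E3 × ℝ))
  have hfin' := (measurePreserving_timeShift (-ε)).quasiMeasurePreserving.tendsto_ae.eventually hfin
  rw [hPA, hPA]
  have hAA : A = timeShift (-ε) ⁻¹' (timeShift ε ⁻¹' A) := (timeShift_neg_preimage ε A).symm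
  have e1 : ∫⁻ p in timeShift ε ⁻¹' A, P.rnDeriv volume p
      = ∫⁻ p in A, P.rnDeriv volume (timeShift (-ε) p) := by
    conv_rhs => rw [hAA]
    exact ((measurePreserving_timeShift (-ε)).setLIntegral_comp_preimage hA' hm).symm
  rw [e1]
  calc ∫⁻ p in A, P.rnDeriv volume (timeShift (-ε) p)
      ≤ ∫⁻ p in A, (P.rnDeriv volume p + ‖(P.rnDeriv volume (timeShift (-ε) p)).toReal
          - (P.rnDeriv volume p).toReal‖ₑ) := by
        refine lintegral_mono_ae (ae_restrict_of_ae ?_)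
        filter_upwards [hfin, hfin'] with p h1 h2
        conv_lhs => rw [← ENNReal.ofReal_toReal h2.ne]
        conv_rhs => enter [1]; rw [← ENNReal.ofReal_toReal h1.ne]
        rw [Real.enorm_eq_ofReal_abs, ← ENNReal.ofReal_add ENNReal.toReal_nonneg (abs_nonneg _)]
        refine ENNReal.ofReal_le_ofReal ?_
        linarith [le_abs_self ((P.rnDeriv volume (timeShift (-ε) p)).toReal
          - (P.rnDeriv volume p).toReal)]
    _ = (∫⁻ p in A, P.rnDeriv volume p) + ∫⁻ p in A, ‖(P.rnDeriv volume (timeShift (-ε) p)).toReal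
          - (P.rnDeriv volume p).toReal‖ₑ := lintegral_add_left (μ := volume.restrict A) hm _
    _ ≤ _ := by
        refine add_le_add le_rfl ?_
        exact (setLIntegral_le_lintegral _ _).trans hε.le

/-! ### Null sets and sums of distances -/

/-- The preimage of a null set under a function with nonzero derivative off a point is null. -/
theorem volume_preimage_eq_zero {h h' : ℝ → ℝ} (t₀ : ℝ) (hd : ∀ t, t ≠ t₀ → HasDerivAt h (h' t) t)
    (hpos : ∀ t, t₀ < t → 0 < h' t) (hneg : ∀ t, t < t₀ → h' t < 0) (hc : Measurable h)
    (hm : Measurable h')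
    {N : Set ℝ} (hN : MeasurableSet N) (hN0 : volume N = 0) : volume (h ⁻¹' N) = 0 := by
  -- Where `h` is injective, the integral of `|h'|` over the preimage is the measure of its image, a
  -- null set; as `h' ≠ 0`, the preimage is null.
  have key : ∀ s : Set ℝ, MeasurableSet s → Set.InjOn h s → (∀ t ∈ s, t ≠ t₀) →
      volume (h ⁻¹' N ∩ s) = 0 := fun s hs hi hne => by
    have hms : MeasurableSet (h ⁻¹' N ∩ s) := (hc hN).inter hs
    have h1 := lintegral_image_eq_lintegral_abs_deriv_mul hms
      (fun t ht => (hd t (hne t ht.2)).hasDerivWithinAt) (hi.mono Set.inter_subset_right)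
      (fun _ => 1)
    have h2 : volume (h '' (h ⁻¹' N ∩ s)) = 0 :=
      measure_mono_null (by rintro _ ⟨t, ht, rfl⟩; exact ht.1) hN0
    simp only [lintegral_one, Measure.restrict_apply_univ, h2, mul_one] at h1
    rw [eq_comm, lintegral_eq_zero_iff (by fun_prop), Filter.EventuallyEq,
      ae_restrict_iff' hms] at h1
    rw [measure_eq_zero_iff_ae_notMem]
    filter_upwards [h1] with t ht hts
    have := ht hts
    simp only [Pi.zero_apply, ENNReal.ofReal_eq_zero, abs_nonpos_iff] at this
    rcases lt_or_gt_of_ne (hne t hts.2) with hlt | hlt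
    · exact (hneg t hlt).ne this
    · exact (hpos t hlt).ne' this
  -- By Rolle's theorem, `h` is injective on each side of `t₀`.
  have hI : Set.InjOn h (Set.Ioi t₀) := fun s hs t ht hst => by
    by_contra hne
    wlog hlt : s < t generalizing s t
    · exact this t ht s hs hst.symm (Ne.symm hne) (lt_of_le_of_ne (not_lt.1 hlt) (Ne.symm hne))
    obtain ⟨c, hc, hc'⟩ := exists_hasDerivAt_eq_zero hlt
      (fun u hu => (hd u (hs.trans_le hu.1).ne').continuousAt.continuousWithinAt) hst
      (fun u hu => hd u (hs.trans hu.1).ne')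
    exact (hpos c (hs.trans hc.1)).ne' hc'
  have hI' : Set.InjOn h (Set.Iio t₀) := fun s hs t ht hst => by
    by_contra hne
    wlog hlt : s < t generalizing s t
    · exact this t ht s hs hst.symm (Ne.symm hne) (lt_of_le_of_ne (not_lt.1 hlt) (Ne.symm hne))
    obtain ⟨c, hc, hc'⟩ := exists_hasDerivAt_eq_zero hlt
      (fun u hu => (hd u (hu.2.trans_lt ht).ne).continuousAt.continuousWithinAt) hst
      (fun u hu => hd u (hu.2.trans ht).ne)
    exact (hneg c (hc.2.trans ht)).ne hc'
  refine measure_mono_null (t := (h ⁻¹' N ∩ Set.Ioi t₀) ∪ (h ⁻¹' N ∩ Set.Iio t₀) ∪ {t₀}) ?_ ?_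
  · intro t ht
    rcases lt_trichotomy t t₀ with h | h | h
    · exact Or.inl (Or.inr ⟨ht, h⟩)
    · exact Or.inr h
    · exact Or.inl (Or.inl ⟨ht, h⟩)
  · exact measure_union_null (measure_union_null
      (key _ measurableSet_Ioi hI fun t ht => (ne_of_gt ht))
      (key _ measurableSet_Iio hI' fun t ht => (ne_of_lt ht))) (by simp)

/-- On a line with direction `v ⟂ x`, the derivatives of `|z|` and `|x - z|` have the same
numerator, so both change sign at the same single point and cannot cancel elsewhere. Hence the set
is null on every such line, and so in space. -/
theorem volume_sum_dist_preimage_eq_zero (x : E3) {N : Set ℝ} (hN : MeasurableSet N)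
    (hN0 : volume N = 0) : volume {z : E3 | ‖z‖ + ‖x - z‖ ∈ N} = 0 := by
  obtain ⟨v, hv, hvx⟩ : ∃ v : E3, v ≠ 0 ∧ inner ℝ x v = 0 := by
    by_cases h : x 0 = 0 ∧ x 1 = 0
    · refine ⟨!₂[1, 0, 0], fun h0 => ?_, ?_⟩
      · simpa using congrArg (fun w : E3 => w 0) h0
      · simp [PiLp.inner_apply, Fin.sum_univ_three, h.1]
    · refine ⟨!₂[-x 1, x 0, 0], fun h0 => h ⟨?_, ?_⟩, ?_⟩
      · simpa using congrArg (fun w : E3 => w 1) h0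
      · simpa using congrArg (fun w : E3 => w 0) h0
      · simp [PiLp.inner_apply, Fin.sum_univ_three]; ring
  have hms : MeasurableSet {z : E3 | ‖z‖ + ‖x - z‖ ∈ N} :=
    (by fun_prop : Measurable fun z : E3 => ‖z‖ + ‖x - z‖) hN
  have := ae_mem_of_ae_add_linearMap_mem (LinearMap.toSpanSingleton ℝ E3 v) (volume : Measure ℝ)
    (volume : Measure E3) hms.compl (fun y => ?_)
  · rw [measure_eq_zero_iff_ae_notMem]; exact this
  have hv2 : 0 < ‖v‖ ^ 2 := by positivity
  have hder : ∀ q : E3, ∀ t : ℝ, q + t • v ≠ 0 → HasDerivAt (fun t : ℝ => ‖q + t • v‖)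
      ((inner ℝ q v + t * ‖v‖ ^ 2) / ‖q + t • v‖) t := fun q t hq => by
    have h1 : HasDerivAt (fun t : ℝ => q + t • v) v t := by
      simpa using ((hasDerivAt_id t).smul_const v).const_add q
    have h2 := h1.norm_sq.sqrt (by positivity)
    simp only [Real.sqrt_sq (norm_nonneg _)] at h2
    convert h2 using 1
    rw [inner_add_left, inner_smul_left, real_inner_self_eq_norm_sq]
    simp; field_simp
  set c : ℝ := inner ℝ y v with hcdef
  have hc' : inner ℝ (y - x) v = c := by rw [inner_sub_left, hvx, sub_zero]
  have hnz : ∀ q : E3, inner ℝ q v = c → ∀ t : ℝ, t ≠ -c / ‖v‖ ^ 2 → q + t • v ≠ 0 := by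
    intro q hq t ht h0
    apply ht
    have : inner ℝ (q + t • v) v = (0 : ℝ) := by rw [h0, inner_zero_left]
    rw [inner_add_left, inner_smul_left, real_inner_self_eq_norm_sq, hq] at this
    simp at this
    rw [eq_div_iff hv2.ne']; linarith
  have main := volume_preimage_eq_zero (h := fun t : ℝ => ‖y + t • v‖ + ‖(y - x) + t • v‖)
    (h' := fun t => (c + t * ‖v‖ ^ 2) / ‖y + t • v‖ + (c + t * ‖v‖ ^ 2) / ‖(y - x) + t • v‖)
    (-c / ‖v‖ ^ 2) (fun t ht => by
      have h1 := hder y t (hnz y rfl t ht)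
      have h2 := hder (y - x) t (hnz _ hc' t ht)
      rw [hc'] at h2
      exact h1.add h2) (fun t ht => by
      have h1 := hnz y rfl t ht.ne'
      have h2 := hnz _ hc' t ht.ne'
      have h3 : 0 < c + t * ‖v‖ ^ 2 := by rw [div_lt_iff₀ hv2] at ht; linarith
      positivity) (fun t ht => by
      have h1 := hnz y rfl t ht.ne
      have h2 := hnz _ hc' t ht.ne
      have h3 : c + t * ‖v‖ ^ 2 < 0 := by rw [lt_div_iff₀ hv2] at ht; linarith
      exact add_neg (div_neg_of_neg_of_pos h3 (by positivity))
        (div_neg_of_neg_of_pos h3 (by positivity)))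
    (by fun_prop) (by fun_prop) hN hN0
  rw [measure_eq_zero_iff_ae_notMem] at main
  filter_upwards [main] with t ht h
  apply ht
  simp only [Set.mem_ofPred_eq, LinearMap.toSpanSingleton_apply, Set.mem_preimage] at h ⊢
  rwa [norm_sub_rev, add_sub_right_comm] at h

/-! ### Wave kernels and their composition -/

@[fun_prop]
theorem measurable_waveWeight : Measurable waveWeight := by
  unfold waveWeight
  exact ENNReal.measurable_ofReal.comp
    (Measurable.ite measurableSet_Ici (by fun_prop) measurable_const)

/-- The factor `1 / (4 π)` is dropped; at `t = 0` the right side is `∞`. -/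
theorem waveWeight_le {t : ℝ} (ht : 0 ≤ t) : waveWeight t ≤ (ENNReal.ofReal t)⁻¹ := by
  rcases ht.eq_or_lt with rfl | h
  · simp
  · rw [waveWeight, if_pos ht, ← ENNReal.ofReal_inv_of_pos h]
    refine ENNReal.ofReal_le_ofReal ?_
    rw [one_div]
    refine inv_anti₀ h ?_
    nlinarith [Real.pi_gt_three]

theorem waveWeight_norm_le (v : E3) : waveWeight ‖v‖ ≤ ‖v‖ₑ⁻¹ := by
  rw [← ofReal_norm]; exact waveWeight_le (norm_nonneg v)

theorem lintegral_waveKernel (μ : Measure E3) [SFinite μ] (y : E3) {f : E3 × ℝ → ℝ≥0∞}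
    (hf : Measurable f) :
    ∫⁻ p, f p ∂waveKernel μ y = ∫⁻ x, waveWeight ‖x - y‖ * f (x, ‖x - y‖) ∂μ := by
  rw [waveKernel, Kernel.lintegral_withDensity _ (by fun_prop) _ hf,
    Kernel.lintegral_compProd _ _ _ (by fun_prop), Kernel.const_apply]
  refine lintegral_congr fun x => ?_
  rw [Kernel.lintegral_deterministic' _ (by fun_prop)]

/-- The composition of the kernels `waveKernel μ` and `waveKernel ν`, evaluated at the point `y`
and the set `A`. -/
noncomputable def waveConv (μ ν : Measure E3) (y : E3) (A : Set (E3 × ℝ)) : ℝ≥0∞ :=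
  ∫⁻ z, waveWeight ‖z - y‖ *
    ∫⁻ x, waveWeight ‖x - z‖ * A.indicator 1 (x, ‖z - y‖ + ‖x - z‖) ∂μ ∂ν

theorem measurable_waveConv_integrand {A : Set (E3 × ℝ)} (hA : MeasurableSet A) (y : E3) :
    Measurable fun q : E3 × E3 =>
      waveWeight ‖q.2 - q.1‖ * A.indicator (1 : E3 × ℝ → ℝ≥0∞) (q.2, ‖q.1 - y‖ + ‖q.2 - q.1‖) := by
  have h : Measurable (A.indicator (1 : E3 × ℝ → ℝ≥0∞)) := measurable_one.indicator hA
  fun_prop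

theorem measurable_waveConv_inner (μ : Measure E3) [SFinite μ] {A : Set (E3 × ℝ)}
    (hA : MeasurableSet A) (y : E3) : Measurable fun z : E3 => waveWeight ‖z - y‖ *
      ∫⁻ x, waveWeight ‖x - z‖ * A.indicator 1 (x, ‖z - y‖ + ‖x - z‖) ∂μ := by
  have h := (measurable_waveConv_integrand hA y).lintegral_prod_right' (ν := μ)
  fun_prop

theorem convPos_waveKernel_apply (μ ν : Measure E3) [SFinite μ] [SFinite ν] (y : E3)
    {A : Set (E3 × ℝ)} (hA : MeasurableSet A) :
    TimeKernel.convPos (waveKernel μ) (waveKernel ν) y A = waveConv μ ν y A := by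
  have hm : Measurable fun w : (E3 × ℝ) × (E3 × ℝ) => (w.2.1, w.1.2 + w.2.2) := by fun_prop
  have hind : Measurable (A.indicator (1 : E3 × ℝ → ℝ≥0∞)) := measurable_one.indicator hA
  rw [TimeKernel.convPos, ← lintegral_indicator_one hA, Kernel.lintegral_map _ hm _ hind,
    Kernel.lintegral_compProd _ _ _ (by fun_prop), lintegral_waveKernel]
  · unfold waveConv
    refine lintegral_congr fun z => ?_
    rw [Kernel.comap_apply, lintegral_waveKernel _ _ (by fun_prop)]
  · exact Measurable.lintegral_kernel_prod_right'' (a := y)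
      (η := (waveKernel μ).comap (fun q : E3 × (E3 × ℝ) => q.2.1)
        (measurable_fst.comp measurable_snd))
      (f := fun w : (E3 × ℝ) × (E3 × ℝ) => A.indicator (1 : E3 × ℝ → ℝ≥0∞)
        (w.2.1, w.1.2 + w.2.2)) (by fun_prop)

theorem waveConv_mono {μ μ' ν ν' : Measure E3} (hμ : μ ≤ μ') (hν : ν ≤ ν') (y : E3)
    (A : Set (E3 × ℝ)) : waveConv μ ν y A ≤ waveConv μ' ν' y A := by
  unfold waveConv
  exact lintegral_mono' hν fun z => mul_le_mul_right (lintegral_mono' hμ le_rfl) _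

theorem waveConv_add_left (μ μ' ν : Measure E3) [SFinite μ] (y : E3)
    {A : Set (E3 × ℝ)} (hA : MeasurableSet A) :
    waveConv (μ + μ') ν y A = waveConv μ ν y A + waveConv μ' ν y A := by
  unfold waveConv
  rw [← lintegral_add_left (measurable_waveConv_inner μ hA y)]
  simp only [lintegral_add_measure, mul_add]

theorem waveConv_add_right (μ ν ν' : Measure E3) (y : E3) (A : Set (E3 × ℝ)) :
    waveConv μ (ν + ν') y A = waveConv μ ν y A + waveConv μ ν' y A := by
  unfold waveConv
  rw [lintegral_add_measure]

/-! ### Kato norm bounds for the composition -/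

theorem katoNorm_mono {μ ν : Measure E3} (h : μ ≤ ν) : katoNorm μ ≤ katoNorm ν :=
  iSup_mono fun _ => lintegral_mono' h le_rfl

theorem katoNorm_add_le (μ ν : Measure E3) : katoNorm (μ + ν) ≤ katoNorm μ + katoNorm ν := by
  refine iSup_le fun y => ?_
  rw [lintegral_add_measure]
  exact add_le_add (le_iSup (fun y : E3 => ∫⁻ x, ‖x - y‖ₑ⁻¹ ∂μ) y)
    (le_iSup (fun y : E3 => ∫⁻ x, ‖x - y‖ₑ⁻¹ ∂ν) y)

theorem lintegral_waveWeight_le (μ : Measure E3) (y : E3) :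
    ∫⁻ x, waveWeight ‖x - y‖ ∂μ ≤ katoNorm μ :=
  (lintegral_mono fun x => waveWeight_norm_le (x - y)).trans
    (le_iSup (fun y : E3 => ∫⁻ x, ‖x - y‖ₑ⁻¹ ∂μ) y)

/-- The inner integral is at most `katoNorm μ` for every `z`. The outer one is kept because its
decay in `y` is used for distant poles. -/
theorem waveConv_le_mul_lintegral (μ ν : Measure E3) (y : E3) (A : Set (E3 × ℝ)) :
    waveConv μ ν y A ≤ katoNorm μ * ∫⁻ z, waveWeight ‖z - y‖ ∂ν := by
  unfold waveConv
  rw [← lintegral_const_mul _ (by fun_prop)]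
  refine lintegral_mono fun z => ?_
  rw [mul_comm]
  refine mul_le_mul_left ((lintegral_mono fun x => ?_).trans (lintegral_waveWeight_le μ z)) _
  exact mul_le_of_le_one_right' (Set.indicator_le_self _ _ _)

theorem waveConv_le (μ ν : Measure E3) (y : E3) (A : Set (E3 × ℝ)) :
    waveConv μ ν y A ≤ katoNorm μ * katoNorm ν :=
  (waveConv_le_mul_lintegral μ ν y A).trans (mul_le_mul_right (lintegral_waveWeight_le ν y) _)

/-- If `p - n` is close to `a - b`, then its square is close to the square of `a - b`. -/
theorem waveConv_square_near {p n a b D : Measure E3} [SFinite p] [SFinite n] [SFinite a]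
    [SFinite b] (h : p + b ≤ n + a + D) (h' : n + a ≤ p + b + D) {K e : ℝ≥0∞} (hK : K ≠ ⊤)
    (hp : katoNorm p ≤ K) (hn : katoNorm n ≤ K) (ha : katoNorm a ≤ K) (hb : katoNorm b ≤ K)
    (hD : katoNorm D ≤ e) (y : E3) {A : Set (E3 × ℝ)} (hA : MeasurableSet A) :
    waveConv p p y A + waveConv n n y A + (waveConv a b y A + waveConv b a y A) ≤
      waveConv p n y A + waveConv n p y A + (waveConv a a y A + waveConv b b y A) +
        4 * (K * e) ∧
    waveConv p n y A + waveConv n p y A + (waveConv a a y A + waveConv b b y A) ≤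
      waveConv p p y A + waveConv n n y A + (waveConv a b y A + waveConv b a y A) +
        4 * (K * e) := by
  have hfin : ∀ μ ν, katoNorm μ ≤ K → katoNorm ν ≤ K → waveConv μ ν y A ≠ ⊤ := fun μ ν h1 h2 =>
    (((waveConv_le μ ν y A).trans (mul_le_mul' h1 h2)).trans_lt
      (ENNReal.mul_lt_top hK.lt_top hK.lt_top)).ne
  have hL : ∀ {s t μ : Measure E3}, s ≤ t + D → katoNorm μ ≤ K → SFinite t →
      waveConv s μ y A ≤ waveConv t μ y A + K * e := fun {s t μ} h1 h2 _ => by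
    refine (waveConv_mono h1 (le_refl μ) y A).trans ?_
    rw [waveConv_add_left _ _ _ y hA, mul_comm]
    exact add_le_add le_rfl ((waveConv_le D μ y A).trans (mul_le_mul' hD h2))
  have hR : ∀ {s t μ : Measure E3}, s ≤ t + D → katoNorm μ ≤ K →
      waveConv μ s y A ≤ waveConv μ t y A + K * e := fun {s t μ} h1 h2 => by
    refine (waveConv_mono (le_refl μ) h1 y A).trans ?_
    rw [waveConv_add_right]
    exact add_le_add le_rfl ((waveConv_le μ D y A).trans (mul_le_mul' h2 hD))
  -- These cross terms cancel in `(p-n)² - (a-b)² = ((p-n) - (a-b)) * (p-n) + (a-b) * ((p-n) -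
  -- (a-b))`; each half below expands this identity into four inequalities with error `K * e`.
  have hc : waveConv b p y A + waveConv a n y A + waveConv a p y A + waveConv b n y A ≠ ⊤ := by
    simp [*]
  constructor
  · have s1 := hL h hp inferInstance
    have s2 := hL h' hn inferInstance
    have s3 := hR h ha
    have s4 := hR h' hb
    simp only [waveConv_add_left _ _ _ y hA, waveConv_add_right] at s1 s2 s3 s4
    rw [← ENNReal.add_le_add_iff_right hc]
    calc _ = (waveConv p p y A + waveConv b p y A) + (waveConv n n y A + waveConv a n y A)
          + (waveConv a p y A + waveConv a b y A) + (waveConv b n y A + waveConv b a y A) := by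
          ring
      _ ≤ _ := add_le_add (add_le_add (add_le_add s1 s2) s3) s4
      _ = _ := by ring
  · have s1 := hL h' hp inferInstance
    have s2 := hL h hn inferInstance
    have s3 := hR h' ha
    have s4 := hR h hb
    simp only [waveConv_add_left _ _ _ y hA, waveConv_add_right] at s1 s2 s3 s4
    rw [← ENNReal.add_le_add_iff_right hc]
    calc _ = (waveConv n p y A + waveConv a p y A) + (waveConv p n y A + waveConv b n y A)
          + (waveConv a n y A + waveConv a a y A) + (waveConv b p y A + waveConv b b y A) := by
          ring
      _ ≤ _ := add_le_add (add_le_add (add_le_add s1 s2) s3) s4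
      _ = _ := by ring

/-! ### Continuous compactly supported potentials -/

/-- In polar coordinates the radial integrand is `r² · r⁻¹ = r`. -/
theorem setLIntegral_inv_enorm_lt_top : ∫⁻ x in Metric.ball (0 : E3) 1, ‖x‖ₑ⁻¹ < ⊤ := by
  have h : IntegrableOn (fun x : E3 => (‖x‖)⁻¹) (Metric.ball 0 1) := by
    refine (integrableOn_fun_norm_addHaar volume (f := fun t : ℝ => t⁻¹)).2 ?_
    have h2 : IntegrableOn (fun t : ℝ => t) (Set.Ioo 0 1) :=
      (continuous_id.integrableOn_Icc (a := 0) (b := 1)).mono_set Set.Ioo_subset_Icc_self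
    refine h2.congr_fun (fun t ht => ?_) measurableSet_Ioo
    have := ht.1.ne'
    simp only [finrank_euclideanSpace_fin, smul_eq_mul]
    field_simp
  refine lt_of_le_of_lt (lintegral_mono_ae ?_) h.hasFiniteIntegral
  filter_upwards [ae_restrict_of_ae (Measure.ae_ne volume (0 : E3))] with x hx
  rw [enorm_inv (norm_ne_zero_iff.2 hx), enorm_norm]

/-- The singularity is integrable within distance `1` of `y`, by translation invariance, and beyond
it the integrand is at most `1`. -/
theorem katoNorm_restrict_closedBall_lt_top (R : ℝ) :
    katoNorm (volume.restrict (Metric.closedBall (0 : E3) R)) < ⊤ := by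
  have hB : MeasurableSet (Metric.ball (0 : E3) 1) := Metric.isOpen_ball.measurableSet
  refine lt_of_le_of_lt (b := (∫⁻ x in Metric.ball (0 : E3) 1, ‖x‖ₑ⁻¹) +
    volume (Metric.closedBall (0 : E3) R)) (iSup_le fun y => ?_)
    (ENNReal.add_lt_top.2 ⟨setLIntegral_inv_enorm_lt_top,
      (isCompact_closedBall (0 : E3) R).measure_lt_top⟩)
  calc ∫⁻ x in Metric.closedBall (0 : E3) R, ‖x - y‖ₑ⁻¹
      ≤ ∫⁻ x in Metric.closedBall (0 : E3) R,
        ((Metric.ball (0 : E3) 1).indicator (fun x => ‖x‖ₑ⁻¹) (x - y) + 1) := by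
        refine lintegral_mono fun x => ?_
        by_cases hx : x - y ∈ Metric.ball (0 : E3) 1
        · rw [Set.indicator_of_mem hx]; exact le_self_add
        · refine le_add_left (ENNReal.inv_le_one.2 ?_)
          rw [mem_ball_zero_iff, not_lt] at hx
          rw [← ofReal_norm]
          exact ENNReal.one_le_ofReal.2 hx
    _ = (∫⁻ x in Metric.closedBall (0 : E3) R,
        (Metric.ball (0 : E3) 1).indicator (fun x => ‖x‖ₑ⁻¹) (x - y)) +
          volume (Metric.closedBall (0 : E3) R) := by
        rw [lintegral_add_right _ measurable_const]; simp
    _ ≤ _ := by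
        refine add_le_add ((setLIntegral_le_lintegral _ _).trans ?_) le_rfl
        rw [lintegral_sub_right_eq_self (fun x => (Metric.ball (0 : E3) 1).indicator
          (fun x => ‖x‖ₑ⁻¹) x) y, lintegral_indicator hB]

/-- The measure `f(x) dx`, for a nonnegative function `f`. -/
noncomputable abbrev density (f : E3 → ℝ) : Measure E3 :=
  volume.withDensity fun x => ENNReal.ofReal (f x)

theorem exists_enorm_le_indicator {f : E3 → ℝ} (hf : Continuous f) (hs : HasCompactSupport f) :
    ∃ (M : ℝ≥0∞) (R : ℝ), M ≠ ⊤ ∧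
      ∀ x, ‖f x‖ₑ ≤ (Metric.closedBall (0 : E3) R).indicator (fun _ => M) x := by
  obtain ⟨C, hC⟩ := hs.exists_bound_of_continuous hf
  obtain ⟨R, hR⟩ := hs.isBounded.subset_closedBall 0
  refine ⟨ENNReal.ofReal C, R, ENNReal.ofReal_ne_top, fun x => ?_⟩
  by_cases hx : x ∈ tsupport f
  · rw [Set.indicator_of_mem (hR hx), ← ofReal_norm]
    exact ENNReal.ofReal_le_ofReal (hC x)
  · simp [image_eq_zero_of_notMem_tsupport hx]

/-- The weight of the pair of points `q = (x, z)` in the composition of two wave kernels,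
with pole at the origin. -/
noncomputable def pairWeight (q : E3 × E3) : ℝ≥0∞ := waveWeight ‖q.2‖ * waveWeight ‖q.1 - q.2‖

@[fun_prop]
theorem measurable_pairWeight : Measurable pairWeight := by
  unfold pairWeight; fun_prop

theorem pairWeight_ne_top (q : E3 × E3) : pairWeight q ≠ ⊤ :=
  ENNReal.mul_ne_top ENNReal.ofReal_ne_top ENNReal.ofReal_ne_top

theorem setLIntegral_pairWeight_lt_top (R : ℝ) :
    ∫⁻ q in Metric.closedBall (0 : E3) R ×ˢ Metric.closedBall (0 : E3) R, pairWeight q < ⊤ := by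
  set m := volume.restrict (Metric.closedBall (0 : E3) R) with hm
  have h : ∫⁻ q in Metric.closedBall (0 : E3) R ×ˢ Metric.closedBall (0 : E3) R, pairWeight q
      = waveConv m m 0 Set.univ := by
    rw [Measure.volume_eq_prod, ← Measure.prod_restrict,
      lintegral_prod_symm' _ measurable_pairWeight]
    unfold waveConv pairWeight
    refine lintegral_congr fun z => ?_
    dsimp only
    rw [lintegral_const_mul _ (by fun_prop)]
    simp [hm]
  rw [h]
  have hk := katoNorm_restrict_closedBall_lt_top R
  exact (waveConv_le m m 0 _).trans_lt (ENNReal.mul_lt_top hk hk)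

/-- The density of a pair of potentials, moved by `y`. -/
def pairDensity (f g : E3 → ℝ) (y : E3) (q : E3 × E3) : ℝ := f (q.1 + y) * g (q.2 + y)

/-- The composition of two wave kernels with densities `f` and `g`, based at the point `y` and
translated so that the pole is at the origin. -/
noncomputable def pairMeasure (f g : E3 → ℝ) (y : E3) : Measure (E3 × ℝ) :=
  (volume.withDensity fun q : E3 × E3 => pairWeight q * ENNReal.ofReal (pairDensity f g y q)).map
    fun q => (q.1, ‖q.2‖ + ‖q.1 - q.2‖)

theorem measurable_pairMap :
    Measurable fun q : E3 × E3 => (q.1, ‖q.2‖ + ‖q.1 - q.2‖) := by fun_prop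

section

variable {f g : E3 → ℝ}

theorem measurable_pairDensity (hf : Continuous f) (hg : Continuous g) (y : E3) :
    Measurable (pairDensity f g y) := by
  unfold pairDensity; fun_prop

/-- Recentring moves the dependence on `y` from the singular weight to the continuous densities. -/
theorem waveConv_density_eq (hf : Continuous f) (hg : Continuous g) (hf0 : ∀ x, 0 ≤ f x)
    (y : E3) {A : Set (E3 × ℝ)} (hA : MeasurableSet A) :
    waveConv (density f) (density g) y A =
      pairMeasure f g y ((fun p : E3 × ℝ => (p.1 + y, p.2)) ⁻¹' A) := by
  have hind : Measurable (A.indicator (1 : E3 × ℝ → ℝ≥0∞)) := measurable_one.indicator hA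
  have hA' : MeasurableSet ((fun p : E3 × ℝ => (p.1 + y, p.2)) ⁻¹' A) :=
    (by fun_prop : Measurable fun p : E3 × ℝ => (p.1 + y, p.2)) hA
  have hind' := (measurable_one (α := ℝ≥0∞)).indicator hA'
  have hd := measurable_pairDensity hf hg y
  have e1 : pairMeasure f g y ((fun p : E3 × ℝ => (p.1 + y, p.2)) ⁻¹' A) =
      ∫⁻ q : E3 × E3, (pairWeight q * ENNReal.ofReal (pairDensity f g y q)) *
        A.indicator 1 (q.1 + y, ‖q.2‖ + ‖q.1 - q.2‖) := by
    rw [pairMeasure, ← lintegral_indicator_one hA',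
      lintegral_map hind' measurable_pairMap,
      lintegral_withDensity_eq_lintegral_mul _ (by fun_prop) (by fun_prop)]
    rfl
  rw [e1, Measure.volume_eq_prod, lintegral_prod_symm' _ (by fun_prop), waveConv,
    lintegral_withDensity_eq_lintegral_mul _ (by fun_prop)
      (measurable_waveConv_inner (density f) hA y), ← lintegral_add_right_eq_self _ y]
  refine lintegral_congr fun z => ?_
  simp only [Pi.mul_apply, add_sub_cancel_right]
  rw [lintegral_withDensity_eq_lintegral_mul _ (by fun_prop) (by fun_prop),
    ← lintegral_add_right_eq_self _ y, ← mul_assoc, ← lintegral_const_mul _ (by fun_prop)]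
  refine lintegral_congr fun x => ?_
  simp only [Pi.mul_apply, add_sub_add_right_eq_sub, pairWeight, pairDensity,
    ENNReal.ofReal_mul (hf0 _)]
  ring

/-- By Fubini, it suffices to treat the slice at a fixed `x`, where only the sum of distances
varies. -/
theorem pairMeasure_absolutelyContinuous (f g : E3 → ℝ) (y : E3) :
    pairMeasure f g y ≪ volume := by
  refine Measure.AbsolutelyContinuous.mk fun N hN hN0 => ?_
  rw [pairMeasure, Measure.map_apply measurable_pairMap hN]
  refine withDensity_absolutelyContinuous _ _ ?_
  rw [Measure.volume_eq_prod, Measure.measure_prod_null hN] at hN0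
  rw [Measure.volume_eq_prod, Measure.measure_prod_null (measurable_pairMap hN)]
  filter_upwards [hN0] with x hx
  exact volume_sum_dist_preimage_eq_zero x (measurable_prodMk_left hN) hx

/-- For bounded `y` the moved supports stay in one ball, which gives a dominating function
independent of `y`. -/
theorem exists_enorm_pairDensity_le (hf : Continuous f) (hg : Continuous g)
    (hfs : HasCompactSupport f) (hgs : HasCompactSupport g) (ρ : ℝ) :
    ∃ (M : ℝ≥0∞) (R : ℝ), M ≠ ⊤ ∧ ∀ y : E3, ‖y‖ ≤ ρ → ∀ q, ‖pairDensity f g y q‖ₑ ≤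
      (Metric.closedBall (0 : E3) R ×ˢ Metric.closedBall (0 : E3) R).indicator (fun _ => M) q := by
  obtain ⟨M, R, hM, h⟩ := exists_enorm_le_indicator hf hfs
  obtain ⟨M', R', hM', h'⟩ := exists_enorm_le_indicator hg hgs
  refine ⟨M * M', max R R' + ρ, ENNReal.mul_ne_top hM hM', fun y hy q => ?_⟩
  have hz : ∀ {a : E3} {r : ℝ}, r ≤ max R R' → a + y ∈ Metric.closedBall (0 : E3) r →
      a ∈ Metric.closedBall (0 : E3) (max R R' + ρ) := fun {a r} hr ha => by
    rw [mem_closedBall_zero_iff] at ha ⊢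
    have := norm_sub_le (a + y) y
    rw [add_sub_cancel_right] at this
    linarith
  rw [pairDensity, enorm_mul]
  refine (mul_le_mul' (h _) (h' _)).trans ?_
  by_cases h1 : q.1 + y ∈ Metric.closedBall (0 : E3) R
  · by_cases h2 : q.2 + y ∈ Metric.closedBall (0 : E3) R'
    · rw [Set.indicator_of_mem h1, Set.indicator_of_mem h2, Set.indicator_of_mem
        (Set.mk_mem_prod (hz (le_max_left _ _) h1) (hz (le_max_right _ _) h2))]
    · simp [Set.indicator_of_notMem h2]
  · simp [Set.indicator_of_notMem h1]

theorem lintegral_pairWeight_mul_indicator_lt_top (R : ℝ) {M : ℝ≥0∞} (hM : M ≠ ⊤) :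
    ∫⁻ q, pairWeight q * (Metric.closedBall (0 : E3) R ×ˢ Metric.closedBall (0 : E3) R).indicator
      (fun _ => M) q < ⊤ := by
  have hB : MeasurableSet (Metric.closedBall (0 : E3) R ×ˢ Metric.closedBall (0 : E3) R) :=
    Metric.isClosed_closedBall.measurableSet.prod Metric.isClosed_closedBall.measurableSet
  have : ∀ q, pairWeight q * (Metric.closedBall (0 : E3) R ×ˢ
      Metric.closedBall (0 : E3) R).indicator (fun _ => M) q =
      (Metric.closedBall (0 : E3) R ×ˢ Metric.closedBall (0 : E3) R).indicator
        (fun q => pairWeight q * M) q := fun q => (Set.indicator_mul_right _ _ _).symm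
  simp only [this]
  rw [lintegral_indicator hB, lintegral_mul_const _ (by fun_prop)]
  exact ENNReal.mul_lt_top (setLIntegral_pairWeight_lt_top R) hM.lt_top

theorem isFiniteMeasure_pairMeasure (hf : Continuous f) (hg : Continuous g)
    (hfs : HasCompactSupport f) (hgs : HasCompactSupport g) (y : E3) :
    IsFiniteMeasure (pairMeasure f g y) := by
  obtain ⟨M, R, hM, h⟩ := exists_enorm_pairDensity_le hf hg hfs hgs ‖y‖
  have := isFiniteMeasure_withDensity (μ := volume)
    (f := fun q => pairWeight q * ENNReal.ofReal (pairDensity f g y q))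
    (((lintegral_mono fun q => mul_le_mul_right ((Real.ofReal_le_enorm _).trans
      (h y le_rfl q)) _).trans_lt (lintegral_pairWeight_mul_indicator_lt_top R hM)).ne)
  unfold pairMeasure
  infer_instance

theorem tendsto_lintegral_pairDensity_sub (hf : Continuous f) (hg : Continuous g)
    (hfs : HasCompactSupport f) (hgs : HasCompactSupport g) (y : E3) :
    Tendsto (fun y' => ∫⁻ q, pairWeight q * ‖pairDensity f g y' q - pairDensity f g y q‖ₑ)
      (𝓝 y) (𝓝 0) := by
  obtain ⟨M, R, hM, h⟩ := exists_enorm_pairDensity_le hf hg hfs hgs (‖y‖ + 1)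
  have hd := measurable_pairDensity hf hg
  have key := tendsto_lintegral_filter_of_dominated_convergence (μ := volume) (l := 𝓝 y)
    (F := fun y' q => pairWeight q * ‖pairDensity f g y' q - pairDensity f g y q‖ₑ)
    (f := fun _ => 0)
    (fun q => pairWeight q * (Metric.closedBall (0 : E3) R ×ˢ
      Metric.closedBall (0 : E3) R).indicator (fun _ => M + M) q)
    (Eventually.of_forall fun y' => by have h1 := hd y'; have h2 := hd y; fun_prop) ?_
    (lintegral_pairWeight_mul_indicator_lt_top R (ENNReal.add_ne_top.2 ⟨hM, hM⟩)).ne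
    (Eventually.of_forall fun q => ?_)
  · simpa using key
  · filter_upwards [Metric.ball_mem_nhds y one_pos] with y' hy'
    refine Eventually.of_forall fun q => mul_le_mul_right ?_ _
    have hy1 : ‖y'‖ ≤ ‖y‖ + 1 := by
      have := norm_le_norm_add_norm_sub' y' y
      rw [mem_ball_iff_norm] at hy'
      linarith
    refine (enorm_sub_le).trans ((add_le_add (h y' hy1 q) (h y (by linarith) q)).trans ?_)
    exact (congrFun (Set.indicator_add _ (fun _ => M) fun _ => M) q).ge
  · have h0 : Tendsto (fun y' => ‖pairDensity f g y' q - pairDensity f g y q‖ₑ) (𝓝 y) (𝓝 0) := by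
      have : Continuous fun y' => ‖pairDensity f g y' q - pairDensity f g y q‖ₑ := by
        unfold pairDensity; fun_prop
      simpa using this.tendsto y
    simpa using ENNReal.Tendsto.const_mul h0 (Or.inr (pairWeight_ne_top q))

theorem pairMeasure_le_add (hf : Continuous f) (hg : Continuous g) (y y' : E3)
    {B : Set (E3 × ℝ)} (hB : MeasurableSet B) :
    pairMeasure f g y' B ≤ pairMeasure f g y B +
      ∫⁻ q, pairWeight q * ‖pairDensity f g y' q - pairDensity f g y q‖ₑ := by
  have hd := measurable_pairDensity hf hg
  have h1 := hd y
  have h2 := hd y'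
  have hB' := measurable_pairMap hB
  rw [pairMeasure, pairMeasure, Measure.map_apply measurable_pairMap hB,
    Measure.map_apply measurable_pairMap hB, withDensity_apply _ hB', withDensity_apply _ hB']
  refine le_trans ?_ (add_le_add le_rfl (setLIntegral_le_lintegral ((fun q : E3 × E3 => (q.1, ‖q.2‖ + ‖q.1 - q.2‖)) ⁻¹' B) _))
  rw [← lintegral_add_left (by fun_prop)]
  refine lintegral_mono fun q => ?_
  rw [← mul_add]
  refine mul_le_mul_right ?_ _
  calc ENNReal.ofReal (pairDensity f g y' q)
      = ENNReal.ofReal (pairDensity f g y q + (pairDensity f g y' q - pairDensity f g y q)) := by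
        rw [add_sub_cancel]
    _ ≤ _ := ENNReal.ofReal_add_le.trans (add_le_add le_rfl (Real.ofReal_le_enorm _))

/-- Move the pole to `y`, translate there, and move back, at cost `η / 3` each. The neighbourhood is
joint in shift and pole, as the compactness argument requires. -/
theorem eventually_pairMeasure_timeShift_le (hf : Continuous f) (hg : Continuous g)
    (hfs : HasCompactSupport f) (hgs : HasCompactSupport g) (y : E3) {η : ℝ≥0∞} (hη : 0 < η) :
    ∀ᶠ r : ℝ × E3 in 𝓝 (0, y), ∀ A, MeasurableSet A →
      pairMeasure f g r.2 (timeShift r.1 ⁻¹' A) ≤ pairMeasure f g r.2 A + η := by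
  have hη3 : 0 < η / 3 := ENNReal.div_pos hη.ne' (by simp)
  have := isFiniteMeasure_pairMeasure hf hg hfs hgs y
  have h1 := eventually_timeShift_le (pairMeasure_absolutelyContinuous f g y) hη3
  have h2 := (tendsto_lintegral_pairDensity_sub hf hg hfs hgs y).eventually (gt_mem_nhds hη3)
  rw [nhds_prod_eq]
  filter_upwards [h1.prod_mk h2] with r hr A hA
  obtain ⟨hr1, hr2⟩ := hr
  have hr3 : ∫⁻ q, pairWeight q * ‖pairDensity f g y q - pairDensity f g r.2 q‖ₑ < η / 3 := by
    simpa only [enorm_sub_rev] using hr2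
  calc pairMeasure f g r.2 (timeShift r.1 ⁻¹' A)
      ≤ pairMeasure f g y (timeShift r.1 ⁻¹' A) + η / 3 :=
        (pairMeasure_le_add hf hg y r.2 (measurable_timeShift _ hA)).trans
          (add_le_add le_rfl hr2.le)
    _ ≤ pairMeasure f g y A + η / 3 + η / 3 := add_le_add (hr1 A hA) le_rfl
    _ ≤ pairMeasure f g r.2 A + η / 3 + η / 3 + η / 3 := by
        refine add_le_add (add_le_add ?_ le_rfl) le_rfl
        exact (pairMeasure_le_add hf hg r.2 y hA).trans (add_le_add le_rfl hr3.le)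
    _ = pairMeasure f g r.2 A + η := by
        rw [add_assoc, add_assoc, ← add_assoc (η / 3), ENNReal.add_thirds]

theorem katoNorm_density_lt_top (hf : Continuous f) (hfs : HasCompactSupport f) :
    katoNorm (density f) < ⊤ := by
  obtain ⟨M, R, hM, h⟩ := exists_enorm_le_indicator hf hfs
  have hB : MeasurableSet (Metric.closedBall (0 : E3) R) :=
    Metric.isClosed_closedBall.measurableSet
  refine lt_of_le_of_lt (iSup_le fun y => ?_)
    (ENNReal.mul_lt_top hM.lt_top (katoNorm_restrict_closedBall_lt_top R))
  rw [lintegral_withDensity_eq_lintegral_mul _ (by fun_prop) (by fun_prop)]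
  calc ∫⁻ x, ((fun x => ENNReal.ofReal (f x)) * fun x => ‖x - y‖ₑ⁻¹) x
      ≤ ∫⁻ x, (Metric.closedBall (0 : E3) R).indicator (fun x => M * ‖x - y‖ₑ⁻¹) x := by
        refine lintegral_mono fun x => ?_
        rw [Set.indicator_mul_left]
        exact mul_le_mul_left ((Real.ofReal_le_enorm _).trans (h x)) _
    _ = M * ∫⁻ x in Metric.closedBall (0 : E3) R, ‖x - y‖ₑ⁻¹ := by
        rw [lintegral_indicator hB, lintegral_const_mul _ (by fun_prop)]
    _ ≤ _ := mul_le_mul_right (le_iSup (fun y : E3 => ∫⁻ x in Metric.closedBall (0 : E3) R,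
        ‖x - y‖ₑ⁻¹) y) _

theorem exists_waveConv_density_le_of_far (hf : Continuous f) (hg : Continuous g)
    (hfs : HasCompactSupport f) (hgs : HasCompactSupport g) {η : ℝ≥0∞} (hη : 0 < η) :
    ∃ R : ℝ, ∀ y : E3, R < ‖y‖ → ∀ A, waveConv (density f) (density g) y A ≤ η := by
  obtain ⟨M, R, hM, h⟩ := exists_enorm_le_indicator hg hgs
  have hB : MeasurableSet (Metric.closedBall (0 : E3) R) :=
    Metric.isClosed_closedBall.measurableSet
  by_cases hη' : η = ⊤
  · exact ⟨0, fun _ _ _ => hη' ▸ le_top⟩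
  set C := katoNorm (density f) * (M * volume (Metric.closedBall (0 : E3) R)) with hC
  have hCt : C ≠ ⊤ := ENNReal.mul_ne_top (katoNorm_density_lt_top hf hfs).ne
    (ENNReal.mul_ne_top hM (isCompact_closedBall (0 : E3) R).measure_lt_top.ne)
  have hCη : C / η ≠ ⊤ := ENNReal.div_ne_top hCt hη.ne'
  -- Beyond this radius `C / (‖y‖ - R) ≤ η`, where `‖y‖ - R` bounds from below the distance from `y`
  -- to the support of `g`.
  refine ⟨R + (C / η).toReal, fun y hy A => ?_⟩
  have hpos : 0 < ‖y‖ - R := by linarith [ENNReal.toReal_nonneg (a := C / η)]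
  have hle : C / η ≤ ENNReal.ofReal (‖y‖ - R) := by
    rw [← ENNReal.ofReal_toReal hCη]; exact ENNReal.ofReal_le_ofReal (by linarith)
  have hint : ∫⁻ z, waveWeight ‖z - y‖ ∂density g ≤
      M * volume (Metric.closedBall (0 : E3) R) * (ENNReal.ofReal (‖y‖ - R))⁻¹ := by
    rw [lintegral_withDensity_eq_lintegral_mul _ (by fun_prop) (by fun_prop)]
    calc ∫⁻ x, ((fun x => ENNReal.ofReal (g x)) * fun z => waveWeight ‖z - y‖) x
        ≤ ∫⁻ x, (Metric.closedBall (0 : E3) R).indicator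
            (fun _ => M * (ENNReal.ofReal (‖y‖ - R))⁻¹) x := by
          refine lintegral_mono fun x => ?_
          refine (mul_le_mul_left ((Real.ofReal_le_enorm _).trans (h x)) _).trans ?_
          by_cases hx : x ∈ Metric.closedBall (0 : E3) R
          · rw [Set.indicator_of_mem hx, Set.indicator_of_mem hx]
            refine mul_le_mul_right ((waveWeight_le (norm_nonneg _)).trans ?_) _
            refine ENNReal.inv_le_inv.2 (ENNReal.ofReal_le_ofReal ?_)
            rw [mem_closedBall_zero_iff] at hx
            have := norm_sub_norm_le y x
            rw [norm_sub_rev] at this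
            linarith
          · simp [Set.indicator_of_notMem hx]
      _ = _ := by rw [lintegral_indicator_const hB]; ring
  refine (waveConv_le_mul_lintegral _ _ y A).trans ((mul_le_mul_right hint _).trans ?_)
  rw [← mul_assoc, ← hC, ← div_eq_mul_inv]
  refine ENNReal.div_le_of_le_mul ?_
  rw [mul_comm]
  exact (ENNReal.div_le_iff hη.ne' hη').1 hle

/-- The composition of two wave kernels with continuous compactly supported densities is
continuous under translation in time, uniformly in the base point. -/
theorem eventually_waveConv_density_timeShift_le (hf : Continuous f) (hg : Continuous g)
    (hf0 : ∀ x, 0 ≤ f x) (hfs : HasCompactSupport f) (hgs : HasCompactSupport g)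
    {η : ℝ≥0∞} (hη : 0 < η) :
    ∀ᶠ ε : ℝ in 𝓝 0, ∀ y A, MeasurableSet A →
      waveConv (density f) (density g) y (timeShift ε ⁻¹' A) ≤
        waveConv (density f) (density g) y A + η := by
  obtain ⟨R, hR⟩ := exists_waveConv_density_le_of_far hf hg hfs hgs hη
  have h := (isCompact_closedBall (0 : E3) R).eventually_forall_of_forall_eventually
    (P := fun (ε : ℝ) y => ∀ A, MeasurableSet A →
      pairMeasure f g y (timeShift ε ⁻¹' A) ≤ pairMeasure f g y A + η)
    fun y _ => eventually_pairMeasure_timeShift_le hf hg hfs hgs y hη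
  filter_upwards [h] with ε hε y A hA
  by_cases hy : R < ‖y‖
  -- For a distant pole the left side alone is at most `η`.
  · exact (hR y hy _).trans le_add_self
  · rw [waveConv_density_eq hf hg hf0 y hA,
      waveConv_density_eq hf hg hf0 y (measurable_timeShift ε hA)]
    exact hε y (mem_closedBall_zero_iff.2 (not_lt.1 hy)) _
      ((by fun_prop : Measurable fun p : E3 × ℝ => (p.1 + y, p.2)) hA)

end

/-! ### Decay at infinity -/

/-- The loss of `1` in the radius passes from `R ≤ ‖x - y‖` to the strict inequality of the distal
property. -/
theorem waveKernel_timeGE_le (μ : Measure E3) [SFinite μ] (y : E3) (R : ℝ) :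
    waveKernel μ y {p | R ≤ p.2} ≤ ∫⁻ x in {x | R - 1 < ‖x - y‖}, ‖x - y‖ₑ⁻¹ ∂μ := by
  have hs : MeasurableSet {p : E3 × ℝ | R ≤ p.2} :=
    measurableSet_le measurable_const measurable_snd
  have hs' : MeasurableSet {x : E3 | R - 1 < ‖x - y‖} :=
    measurableSet_lt measurable_const (by fun_prop)
  rw [← lintegral_indicator_one hs, lintegral_waveKernel _ _ (measurable_one.indicator hs),
    ← lintegral_indicator hs']
  refine lintegral_mono fun x => ?_
  by_cases hx : R ≤ ‖x - y‖
  · have hx' : x ∈ {x : E3 | R - 1 < ‖x - y‖} := by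
      rw [Set.mem_ofPred_eq]; linarith
    rw [Set.indicator_of_mem hx']
    exact (mul_le_of_le_one_right' (Set.indicator_le_self _ (1 : E3 × ℝ → ℝ≥0∞) _)).trans
      (waveWeight_norm_le _)
  · rw [Set.indicator_of_notMem (by exact hx), mul_zero]; exact zero_le

theorem norm_truncGE_S_le (V : SignedRadon) (R : ℝ) :
    ((S V).truncGE R).norm ≤
      ⨆ y : E3, ∫⁻ x in {x | R - 1 < ‖x - y‖}, ‖x - y‖ₑ⁻¹ ∂V.variation := by
  refine iSup_mono fun y => (absDiff_le_add _ _ _).trans ?_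
  simp only [TimeKernel.truncGE, S, Measure.add_apply, Kernel.restrict_apply,
    Measure.restrict_apply_univ, SignedRadon.variation, Measure.restrict_add,
    lintegral_add_measure]
  exact add_le_add (waveKernel_timeGE_le _ _ _) (waveKernel_timeGE_le _ _ _)

theorem tendsto_norm_truncGE_S {V : SignedRadon} (h : V.IsDistal) :
    Tendsto (fun R : ℝ => ((S V).truncGE R).norm) atTop (𝓝 0) :=
  tendsto_of_tendsto_of_tendsto_of_le_of_le tendsto_const_nhds
    (h.comp (tendsto_atTop_add_const_right atTop (-1) tendsto_id)) (fun _ => zero_le)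
    fun R => norm_truncGE_S_le V R

/-! ### Continuity under translation -/

/-- This is `|φ| ≤ |V| + D`: where `φ > 0` the negative part vanishes and `h'` applies, elsewhere
`h` does. It bounds the Kato norms of `φ₊` and `φ₋` independently of `φ`. -/
theorem density_add_density_le {p n D : Measure E3} {φ : E3 → ℝ} (hφ : Continuous φ)
    (h : p + density (fun x => -φ x) ≤ n + density φ + D)
    (h' : n + density φ ≤ p + density (fun x => -φ x) + D) :
    density φ + density (fun x => -φ x) ≤ p + n + D := by
  have hs : MeasurableSet {x | 0 < φ x} := measurableSet_lt measurable_const hφ.measurable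
  refine Measure.le_iff.2 fun A hA => ?_
  have hz : density φ (A \ {x | 0 < φ x}) = 0 := by
    rw [withDensity_apply _ (hA.diff hs)]
    refine setLIntegral_eq_zero (hA.diff hs) fun x hx => ?_
    exact ENNReal.ofReal_of_nonpos (not_lt.1 hx.2)
  have hz' : density (fun x => -φ x) (A ∩ {x | 0 < φ x}) = 0 := by
    rw [withDensity_apply _ (hA.inter hs)]
    refine setLIntegral_eq_zero (hA.inter hs) fun x hx => ?_
    exact ENNReal.ofReal_of_nonpos (neg_nonpos.2 (le_of_lt hx.2))
  have h1 := h' (A ∩ {x | 0 < φ x})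
  have h2 := h (A \ {x | 0 < φ x})
  simp only [Measure.add_apply, hz, hz', add_zero] at h1 h2
  rw [← measure_inter_add_sdiff A hs]
  conv_rhs => rw [← measure_inter_add_sdiff A hs]
  simp only [Measure.add_apply, hz, hz', add_zero, zero_add]
  refine add_le_add ((le_add_self.trans h1).trans ?_) ((le_add_self.trans h2).trans ?_)
  · exact add_le_add le_self_add le_rfl
  · exact add_le_add le_add_self le_rfl

/-- A triangle inequality for `u - v` and its translate `u' - v'` through `a - b` and `a' - b'`,
valid after adding the finite terms `a + b + a' + b'`. -/
theorem add_le_add_of_translates {u v a b u' v' a' b' e η : ℝ≥0∞} (ha : a ≠ ⊤) (hb : b ≠ ⊤)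
    (ha' : a' ≠ ⊤) (hb' : b' ≠ ⊤) (h1 : u' + b' ≤ v' + a' + e) (h2 : v + a ≤ u + b + e)
    (h3 : a' ≤ a + η) (h4 : b ≤ b' + η) : u' + v ≤ v' + u + (2 * e + 2 * η) := by
  have hc : a + b + a' + b' ≠ ⊤ := by simp [*]
  rw [← ENNReal.add_le_add_iff_right hc]
  calc u' + v + (a + b + a' + b') = (u' + b') + (v + a) + a' + b := by ring
    _ ≤ _ := add_le_add (add_le_add (add_le_add h1 h2) h3) h4
    _ = _ := by ring

theorem conv_S_pos_apply (V : SignedRadon) (y : E3) {A : Set (E3 × ℝ)} (hA : MeasurableSet A) :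
    ((S V).conv (S V)).pos y A = waveConv V.pos V.pos y A + waveConv V.neg V.neg y A := by
  simp only [TimeKernel.conv, S, _root_.add_apply, Measure.add_apply,
    convPos_waveKernel_apply _ _ y hA]

theorem conv_S_neg_apply (V : SignedRadon) (y : E3) {A : Set (E3 × ℝ)} (hA : MeasurableSet A) :
    ((S V).conv (S V)).neg y A = waveConv V.pos V.neg y A + waveConv V.neg V.pos y A := by
  simp only [TimeKernel.conv, S, _root_.add_apply, Measure.add_apply,
    convPos_waveKernel_apply _ _ y hA]

theorem norm_translate_sub_le {K : TimeKernel} {ε : ℝ} {e : ℝ≥0∞}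
    (hpos : ∀ y, IsFiniteMeasure (K.pos y)) (hneg : ∀ y, IsFiniteMeasure (K.neg y))
    (h : ∀ y A, MeasurableSet A → K.pos y (timeShift ε ⁻¹' A) + K.neg y A ≤
      K.neg y (timeShift ε ⁻¹' A) + K.pos y A + e)
    (h' : ∀ y A, MeasurableSet A → K.neg y (timeShift ε ⁻¹' A) + K.pos y A ≤
      K.pos y (timeShift ε ⁻¹' A) + K.neg y A + e) :
    ((K.translate ε).sub K).norm ≤ e + e := by
  refine iSup_le fun y => ?_
  have e1 : ((K.translate ε).sub K).pos y = (K.pos y).map (timeShift ε) + K.neg y := by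
    simp only [TimeKernel.sub, TimeKernel.translate, _root_.add_apply]
    rw [Kernel.map_apply _ (by fun_prop)]; rfl
  have e2 : ((K.translate ε).sub K).neg y = (K.neg y).map (timeShift ε) + K.pos y := by
    simp only [TimeKernel.sub, TimeKernel.translate, _root_.add_apply]
    rw [Kernel.map_apply _ (by fun_prop)]; rfl
  have := hpos y
  have := hneg y
  rw [e1, e2]
  refine absDiff_univ_le (fun A hA => ?_) fun A hA => ?_
  · simp only [Measure.add_apply, Measure.map_apply (measurable_timeShift ε) hA]
    exact h y A hA
  · simp only [Measure.add_apply, Measure.map_apply (measurable_timeShift ε) hA]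
    exact h' y A hA

theorem eventually_norm_translate_conv_S_le {V : SignedRadon} (hV : V.IsKato) {φ : E3 → ℝ}
    (hφ : Continuous φ) (hs : HasCompactSupport φ) {e : ℝ≥0∞} (he : 0 < e) (he1 : e ≤ 1)
    (hD : katoNorm (V.variationSub φ) ≤ e) :
    ∀ᶠ ε : ℝ in 𝓝 0, ((((S V).conv (S V)).translate ε).sub ((S V).conv (S V))).norm ≤
      (16 * (katoNorm V.variation + 1) + 8) * e := by
  set D := V.variationSub φ with hDdef
  -- The `1` absorbs the Kato norm of `D`, since `e ≤ 1`.
  set K := katoNorm V.variation + 1 with hKdef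
  have hK : K ≠ ⊤ := ENNReal.add_ne_top.2 ⟨hV.ne, ENNReal.one_ne_top⟩
  have hlf1 : IsLocallyFiniteMeasure (density fun x => -φ x) :=
    IsLocallyFiniteMeasure.withDensity_ofReal hφ.neg
  have hlf2 : IsLocallyFiniteMeasure (density φ) := IsLocallyFiniteMeasure.withDensity_ofReal hφ
  have hlf3 : IsLocallyFiniteMeasure V.pos := inferInstance
  have hlf4 : IsLocallyFiniteMeasure V.neg := inferInstance
  have hadd : ∀ μ ν : Measure E3, IsLocallyFiniteMeasure μ → IsLocallyFiniteMeasure ν →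
      IsFiniteMeasureOnCompacts (μ + ν) := fun μ ν _ _ => ⟨fun s hs => by
    rw [Measure.add_apply]
    exact ENNReal.add_lt_top.2 ⟨hs.measure_lt_top, hs.measure_lt_top⟩⟩
  have hlf1' := hadd _ _ hlf3 hlf1
  have hlf2' := hadd _ _ hlf4 hlf2
  have h : V.pos + density (fun x => -φ x) ≤ V.neg + density φ + D := by
    refine (le_sub_add _ (V.neg + density φ)).trans ?_
    rw [add_comm]
    exact add_le_add le_rfl (Measure.le_add_right le_rfl)
  have h' : V.neg + density φ ≤ V.pos + density (fun x => -φ x) + D := by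
    refine (le_sub_add _ (V.pos + density fun x => -φ x)).trans ?_
    rw [add_comm]
    exact add_le_add le_rfl (Measure.le_add_left le_rfl)
  have hle := density_add_density_le hφ h h'
  have hp : katoNorm V.pos ≤ K := (katoNorm_mono (Measure.le_add_right le_rfl)).trans le_self_add
  have hn : katoNorm V.neg ≤ K := (katoNorm_mono (Measure.le_add_left le_rfl)).trans le_self_add
  have hVD : katoNorm (V.pos + V.neg + D) ≤ K :=
    (katoNorm_add_le _ _).trans (add_le_add le_rfl (hD.trans he1))
  have ha : katoNorm (density φ) ≤ K :=
    (katoNorm_mono ((Measure.le_add_right le_rfl).trans hle)).trans hVD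
  have hb : katoNorm (density fun x => -φ x) ≤ K :=
    (katoNorm_mono ((Measure.le_add_left le_rfl).trans hle)).trans hVD
  set a := density φ with hadef
  set b := density (fun x => -φ x) with hbdef
  have hfin : ∀ μ ν, katoNorm μ ≤ K → katoNorm ν ≤ K → ∀ y A, waveConv μ ν y A ≠ ⊤ :=
    fun μ ν h1 h2 y A => (((waveConv_le μ ν y A).trans (mul_le_mul' h1 h2)).trans_lt
      (ENNReal.mul_lt_top hK.lt_top hK.lt_top)).ne
  -- `density ψ` sees only the positive part of `ψ`, which is continuous and nonnegative as the
  -- translation estimate requires.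
  have hpart : ∀ ψ : E3 → ℝ, Continuous ψ → HasCompactSupport ψ →
      Continuous (fun x => max (ψ x) 0) ∧ HasCompactSupport (fun x => max (ψ x) 0) ∧
        density (fun x => max (ψ x) 0) = density ψ := fun ψ h1 h2 =>
    ⟨h1.max continuous_const, h2.comp_left (g := fun t => max t 0) (by simp), by
      unfold density; simp [ENNReal.ofReal_max]⟩
  have hcont : ∀ ψ χ : E3 → ℝ, Continuous ψ → HasCompactSupport ψ → Continuous χ →
      HasCompactSupport χ → ∀ᶠ ε : ℝ in 𝓝 0, ∀ y A, MeasurableSet A →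
      waveConv (density ψ) (density χ) y (timeShift ε ⁻¹' A) ≤
        waveConv (density ψ) (density χ) y A + e ∧
      waveConv (density ψ) (density χ) y A ≤
        waveConv (density ψ) (density χ) y (timeShift ε ⁻¹' A) + e := by
    intro ψ χ h1 h2 h3 h4
    obtain ⟨g1, g2, g3⟩ := hpart ψ h1 h2
    obtain ⟨k1, k2, k3⟩ := hpart χ h3 h4
    have key := eventually_waveConv_density_timeShift_le g1 k1 (fun _ => le_max_right _ _) g2 k2 he
    rw [g3, k3] at key
    have hneg : Tendsto (fun ε : ℝ => -ε) (𝓝 0) (𝓝 0) := by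
      simpa using (continuous_neg (G := ℝ)).tendsto 0
    filter_upwards [key, hneg.eventually key] with ε k k' y A hA
    refine ⟨k y A hA, ?_⟩
    -- The reverse inequality is the estimate for `-ε` on the shifted set.
    have := k' y _ (measurable_timeShift ε hA)
    rwa [timeShift_neg_preimage] at this
  have hsn : HasCompactSupport fun x => -φ x := hs.comp_left (g := fun t => -t) (by simp)
  filter_upwards [hcont _ _ hφ hs hφ hs, hcont _ _ hφ.neg hsn hφ.neg hsn,
    hcont _ _ hφ hs hφ.neg hsn, hcont _ _ hφ.neg hsn hφ hs] with ε haa hbb hab hba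
  have sq := fun y A hA => waveConv_square_near h h' hK hp hn ha hb hD y (A := A) hA
  have E1 : ∀ y A, waveConv a a y A + waveConv b b y A ≠ ⊤ := fun y A =>
    ENNReal.add_ne_top.2 ⟨hfin _ _ ha ha y A, hfin _ _ hb hb y A⟩
  have E2 : ∀ y A, waveConv a b y A + waveConv b a y A ≠ ⊤ := fun y A =>
    ENNReal.add_ne_top.2 ⟨hfin _ _ ha hb y A, hfin _ _ hb ha y A⟩
  have hsum : ∀ {r s t u : ℝ≥0∞}, r ≤ s + e → t ≤ u + e → r + t ≤ s + u + 2 * e :=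
    fun h1 h2 => (add_le_add h1 h2).trans (by ring_nf; rfl)
  -- The square comparison is used at the set and at its shift, giving `2 * (4 * (K * e))`; the
  -- translation estimate is used for two pairs of products, giving `2 * (2 * e)`.
  refine (norm_translate_sub_le (e := 2 * (4 * (K * e)) + 2 * (2 * e)) (fun y => ⟨?_⟩)
    (fun y => ⟨?_⟩) (fun y A hA => ?_) fun y A hA => ?_).trans ?_
  · rw [conv_S_pos_apply V y MeasurableSet.univ]
    exact ENNReal.add_lt_top.2 ⟨(hfin _ _ hp hp y _).lt_top, (hfin _ _ hn hn y _).lt_top⟩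
  · rw [conv_S_neg_apply V y MeasurableSet.univ]
    exact ENNReal.add_lt_top.2 ⟨(hfin _ _ hp hn y _).lt_top, (hfin _ _ hn hp y _).lt_top⟩
  · have hA' := measurable_timeShift ε hA
    rw [conv_S_pos_apply V y hA, conv_S_pos_apply V y hA', conv_S_neg_apply V y hA,
      conv_S_neg_apply V y hA']
    exact add_le_add_of_translates (E1 y A) (E2 y A) (E1 y _) (E2 y _) (sq y _ hA').1
      (sq y A hA).2 (hsum (haa y A hA).1 (hbb y A hA).1) (hsum (hab y A hA).2 (hba y A hA).2)
  · have hA' := measurable_timeShift ε hA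
    rw [conv_S_pos_apply V y hA, conv_S_pos_apply V y hA', conv_S_neg_apply V y hA,
      conv_S_neg_apply V y hA']
    exact add_le_add_of_translates (E2 y A) (E1 y A) (E2 y _) (E1 y _) (sq y _ hA').2
      (sq y A hA).1 (hsum (hab y A hA).1 (hba y A hA).1) (hsum (haa y A hA).2 (hbb y A hA).2)
  · exact le_of_eq (by ring)

end KatoWiener

theorem propositionB9 (V : KatoWiener.SignedRadon) (hV : V.IsKato) :
    (V.IsDistal →
      Tendsto (fun R : ℝ => ((KatoWiener.S V).truncGE R).norm) atTop (𝓝 0)) ∧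
    (V.IsKatoZero →
      Tendsto (fun ε : ℝ =>
        ((((KatoWiener.S V).conv (KatoWiener.S V)).translate ε).sub
          ((KatoWiener.S V).conv (KatoWiener.S V))).norm) (𝓝 0) (𝓝 0)) := by
  refine ⟨KatoWiener.tendsto_norm_truncGE_S, fun h => ENNReal.tendsto_nhds_zero.2 fun δ hδ => ?_⟩
  set C := 16 * (KatoWiener.katoNorm V.variation + 1) + 8 with hC
  have hCt : C ≠ ⊤ := by
    have : KatoWiener.katoNorm V.variation ≠ ⊤ := hV.ne
    finiteness
  -- `C` does not depend on `φ`, so the accuracy can be fixed before `φ` is chosen.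
  have he : 0 < min 1 (δ / C) := lt_min one_pos (ENNReal.div_pos hδ.ne' hCt)
  obtain ⟨φ, hφ, hs, hD⟩ := h.2 _ he
  filter_upwards [KatoWiener.eventually_norm_translate_conv_S_le hV hφ.continuous hs he
    (min_le_left _ _) hD.le] with ε hε
  exact hε.trans ((mul_le_mul_right (min_le_right _ _) _).trans ENNReal.mul_div_le)
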